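/- Let $G$ and $H$ be finite abelian groups, and let $V$ (resp. $V'$) be the regular representation of $G$ (resp. $H$) over $\mathbb{C}$. For a finite-dimensional complex representation $\rho\colon G\to GL(V)$, let $\mathbb{C}[V]$ be the graded algebra of polynomial functions on $V$, let $G$ act on it by $f^g(v)=f(\rho(g)v)$, let $\mathbb{C}[V]^G=\{f\in\mathbb{C}[V] : f^g=f \text{ for all } g\in G\}$ be the graded algebra of polynomial invariants, and let $\mathbb{C}[V]^G_m$ be its homogeneous component of degree $m$. For a positive integer $d$ let $\varphi_G(d)$ denote the number of elements of order $d$ in $G$. Then $$\dim_{\mathbb{C}} \mathbb{C}[V]^G_{|H|}=\dim_{\mathbb{C}} \mathbb{C}[V']^H_{|G|}$$ if and only if $\varphi_G(d)=\varphi_H(d)$ for every positive integer $d$ dividing $\gcd(|G|,|H|)$. -/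

import Mathlib

noncomputable section

/-- The linear forms on a complex vector space `V`, as a subspace of the space of all
functions `V → ℂ`: the image of the dual space `V*`. -/
def linearForms (V : Type*) [AddCommGroup V] [Module ℂ V] : Submodule ℂ (V → ℂ) :=
  LinearMap.range (LinearMap.ltoFun ℂ V ℂ ℂ)

/-- The algebra `ℂ[V]` of polynomial functions on `V`: the subalgebra of the algebra of all
functions `V → ℂ` that is generated by the linear forms. -/
def polyFunctions (V : Type*) [AddCommGroup V] [Module ℂ V] : Subalgebra ℂ (V → ℂ) :=
  Algebra.adjoin ℂ (linearForms V : Set (V → ℂ))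

/-- The component of degree `m` of the graded algebra `ℂ[V]`: the linear span of all products
of `m` linear forms (for `m = 0`, the constants). -/
def polyFunctionsOfDegree (V : Type*) [AddCommGroup V] [Module ℂ V] (m : ℕ) :
    Submodule ℂ (V → ℂ) :=
  linearForms V ^ m

/-- The right action of `G` on functions, `f ^ g (v) = f (ρ(g) v)`; each `g` acts by an algebra
endomorphism. -/
def functionAct {G V : Type*} [Group G] [AddCommGroup V] [Module ℂ V]
    (ρ : Representation ℂ G V) (g : G) : (V → ℂ) →ₐ[ℂ] (V → ℂ) where
  toFun f := fun v => f (ρ g v)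
  map_one' := rfl
  map_mul' _ _ := rfl
  map_zero' := rfl
  map_add' _ _ := rfl
  commutes' _ := rfl

/-- The algebra of polynomial invariants `ℂ[V]^G = {f ∈ ℂ[V] | f ^ g = f for all g ∈ G}`. -/
def polynomialInvariants {G V : Type*} [Group G] [AddCommGroup V] [Module ℂ V]
    (ρ : Representation ℂ G V) : Subalgebra ℂ (V → ℂ) where
  carrier := {f | f ∈ polyFunctions V ∧ ∀ g : G, functionAct ρ g f = f}
  mul_mem' := fun ha hb =>
    ⟨mul_mem ha.1 hb.1, fun g => by rw [map_mul, ha.2 g, hb.2 g]⟩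
  add_mem' := fun ha hb =>
    ⟨add_mem ha.1 hb.1, fun g => by rw [map_add, ha.2 g, hb.2 g]⟩
  algebraMap_mem' := fun c =>
    ⟨Subalgebra.algebraMap_mem _ c, fun g => AlgHom.commutes (functionAct ρ g) c⟩

/-- The component of degree `m` of the graded algebra `ℂ[V]^G`. -/
def invariantsOfDegree {G V : Type*} [Group G] [AddCommGroup V] [Module ℂ V]
    (ρ : Representation ℂ G V) (m : ℕ) : Submodule ℂ (V → ℂ) :=
  Subalgebra.toSubmodule (polynomialInvariants ρ) ⊓ polyFunctionsOfDegree V m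

/-- If `V` is finite dimensional, then so is each component of `ℂ[V]^G`; hence its `finrank` is
its dimension. -/
theorem finiteDimensional_invariantsOfDegree {G V : Type*} [Group G] [AddCommGroup V]
    [Module ℂ V] [FiniteDimensional ℂ V] (ρ : Representation ℂ G V) (m : ℕ) :
    FiniteDimensional ℂ (invariantsOfDegree ρ m) := by
  have h1 : (linearForms V).FG := by
    rw [linearForms, LinearMap.range_eq_map]
    exact Submodule.FG.map _ Module.Finite.fg_top
  have h2 : FiniteDimensional ℂ (polyFunctionsOfDegree V m) :=
    Module.Finite.iff_fg.mpr (h1.pow m)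
  exact Submodule.finiteDimensional_of_le (S₂ := polyFunctionsOfDegree V m) inf_le_right

/-- The number `φ_G(d)` of elements of order `d` in `G`. -/
def numOfOrder (G : Type*) [Group G] (d : ℕ) : ℕ :=
  Nat.card {g : G // orderOf g = d}

end

/-!
Let `n = |G|` and `m = |H|`, write `φ_G(d)` for the number of elements of order `d`, and let
`w_d = C(n / d + m / d, m / d)`, which is symmetric in `G` and `H`.

*Dimension formula.* The coordinates on the group algebra are permuted by `G`, so `G` permutes the
monomials of degree `m`, which form a basis of the polynomial functions of degree `m`
(`linearIndependent_monomialFunction`, `polyFunctionsOfDegree_monoidAlgebra`). Hence the dimension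
of the invariants is the number of orbits of monomials. An element `g` of order `d` fixes the
monomials whose exponents are constant on the cosets of `⟨g⟩`; there are
`multichoose (n / d) (m / d)` of them if `d ∣ m`, and none otherwise. Burnside's lemma then gives
`(n + m) * dim = ∑ φ_G(d) * w_d`, the sum being over the divisors `d` of `gcd n m`
(`add_mul_finrank_invariantsOfDegree`). So the dimensions agree when the numbers `φ` do, and the
converse says that the weighted sums determine the numbers `φ`.

*The first difference dominates.* Suppose that `φ_G` and `φ_H` differ on the divisors of `gcd n m`,
and let `q` be the smallest place where they do. As `φ` is multiplicative, `q = p ^ k` is a power of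
a prime. Say `φ_G(q) < φ_H(q)`. The numbers of solutions of `x ^ q = 1` in the two groups are
distinct powers of `p` divisible by `q`, so `φ_H(q) - φ_G(q) ≥ q` and `p ^ (k + 1) ∣ m`
(`numOfOrder_prime_pow_gap`). It is then enough that the sum of `φ_G(d) * w_d` over the `d > q` with
`φ_G(d) ≠ φ_H(d)` is less than `q * w_q`. Put `a = n / q`.
* For `d ≥ 2 * q` one has `(a + 1) * w_d ≤ w_q`, while `G` has only `q * a` elements.
* If `q < d < 2 * q`, then `d` is coprime to `p` by the minimality of `q`
  (`coprime_of_numOfOrder_ne`), Vandermonde's identity gives `3 * a * w_d ≤ 2 * q * w_q`, and at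
  most `a` elements of `G` have an order coprime to `p`. These orders contribute at most
  `(2 / 3) * q * w_q`; and if one of them occurs, then `a ≥ 3` and `m / q ≥ 6`, so that the bound for
  `d ≥ 2 * q` improves by a factor of `3`.

Thus the weighted sum for `G` is strictly smaller (`sum_numOfOrder_mul_choose_lt`).
-/

/-! ### Estimates for binomial coefficients -/

/-- If the inequality `c * C(a' + b, b) ≤ C(a + 2b, 2b)` holds for some `b`, then it holds for all
larger `b`, because the right-hand side grows at least as fast as the left-hand side. -/
theorem mul_choose_le_choose_two_mul_of_le {a a' c b₀ b : ℕ} (ha : 2 * a' ≤ a) (hb : b₀ ≤ b)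
    (h₀ : c * (a' + b₀).choose b₀ ≤ (a + 2 * b₀).choose (2 * b₀)) :
    c * (a' + b).choose b ≤ (a + 2 * b).choose (2 * b) := by
  induction b, hb using Nat.le_induction with
  | base => exact h₀
  | succ b _ ih =>
    have h1 : (a' + b + 1).choose (b + 1) * (b + 1) = (a' + b + 1) * (a' + b).choose b :=
      (Nat.add_one_mul_choose_eq _ _).symm
    have h2 : (a + 2 * b + 1).choose (2 * b + 1) * (2 * b + 1)
        = (a + 2 * b + 1) * (a + 2 * b).choose (2 * b) := (Nat.add_one_mul_choose_eq _ _).symm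
    have h3 : (a + 2 * b + 2).choose (2 * b + 2) * (2 * b + 2)
        = (a + 2 * b + 2) * (a + 2 * b + 1).choose (2 * b + 1) :=
      (Nat.add_one_mul_choose_eq _ _).symm
    have h4 : (a + 2 * b).choose (2 * b) ≤ (a + 2 * b + 1).choose (2 * b + 1) := by
      refine Nat.le_of_mul_le_mul_right (c := 2 * b + 1) ?_ (by omega)
      rw [h2, mul_comm]
      gcongr
      omega
    refine Nat.le_of_mul_le_mul_right (c := 2 * b + 2) ?_ (by omega)
    rw [show a + 2 * (b + 1) = a + 2 * b + 2 by ring, show 2 * (b + 1) = 2 * b + 2 by ring, h3,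
      show a' + (b + 1) = a' + b + 1 by ring]
    calc c * (a' + b + 1).choose (b + 1) * (2 * b + 2)
        = c * 2 * ((a' + b + 1).choose (b + 1) * (b + 1)) := by ring
      _ = 2 * (a' + b + 1) * (c * (a' + b).choose b) := by rw [h1]; ring
      _ ≤ (a + 2 * b + 2) * (a + 2 * b + 1).choose (2 * b + 1) :=
          Nat.mul_le_mul (by omega) (ih.trans h4)

theorem choose_add_le_choose_add {a b b' : ℕ} (h : b' ≤ b) :
    (a + b').choose b' ≤ (a + b).choose b := by
  rw [← Nat.choose_symm_add, ← Nat.choose_symm_add]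
  exact Nat.choose_le_choose _ (by omega)

theorem add_one_mul_choose_le {a b a' b' : ℕ} (ha : 2 * a' ≤ a) (hb : 2 * b' ≤ b) (hb' : 1 ≤ b') :
    (a + 1) * (a' + b').choose b' ≤ (a + b).choose b := by
  refine (mul_choose_le_choose_two_mul_of_le ha hb' ?_).trans (choose_add_le_choose_add hb)
  have h := Nat.add_one_mul_choose_eq (a + 1) 1
  simp only [Nat.choose_one_right, mul_one] at h ⊢
  nlinarith

theorem three_mul_add_one_mul_choose_le {a b a' b' : ℕ} (ha : 2 * a' ≤ a) (hb : 2 * b' ≤ b)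
    (ha3 : 3 ≤ a) (hb6 : 6 ≤ b) :
    3 * (a + 1) * (a' + b').choose b' ≤ (a + b).choose b := by
  have h₀ : 3 * (a + 1) * (a' + 3).choose 3 ≤ (a + 2 * 3).choose (2 * 3) := by
    have h3 : (a' + 3).choose 3 * 6 = (a' + 3) * ((a' + 2) * (a' + 1)) := by
      have e1 := Nat.add_one_mul_choose_eq (a' + 2) 2
      have e2 := Nat.add_one_mul_choose_eq (a' + 1) 1
      simp only [Nat.choose_one_right] at e1 e2
      linarith [congrArg (fun t => (a' + 3) * t) e2]
    have h6 : (a + 6).choose 6 * 720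
        = (a + 6) * ((a + 5) * ((a + 4) * ((a + 3) * ((a + 2) * (a + 1))))) := by
      have e1 := Nat.add_one_mul_choose_eq (a + 5) 5
      have e2 := Nat.add_one_mul_choose_eq (a + 4) 4
      have e3 := Nat.add_one_mul_choose_eq (a + 3) 3
      have e4 := Nat.add_one_mul_choose_eq (a + 2) 2
      have e5 := Nat.add_one_mul_choose_eq (a + 1) 1
      simp only [Nat.choose_one_right] at e1 e2 e3 e4 e5
      rw [show (a + 2) * (a + 1) = (a + 1 + 1).choose 2 * 2 from e5,
        show (a + 3) * ((a + 1 + 1).choose 2 * 2) = 2 * ((a + 2 + 1) * (a + 2).choose 2) by ring, e4,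
        show (a + 4) * (2 * ((a + 2 + 1).choose (2 + 1) * (2 + 1)))
          = 6 * ((a + 3 + 1) * (a + 3).choose 3) by ring, e3,
        show (a + 5) * (6 * ((a + 3 + 1).choose (3 + 1) * (3 + 1)))
          = 24 * ((a + 4 + 1) * (a + 4).choose 4) by ring, e2,
        show (a + 6) * (24 * ((a + 4 + 1).choose (4 + 1) * (4 + 1)))
          = 120 * ((a + 5 + 1) * (a + 5).choose 5) by ring, e1]
      ring
    have h8 : 8 * ((a' + 3) * ((a' + 2) * (a' + 1))) ≤ (a + 6) * ((a + 4) * (a + 2)) :=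
      calc 8 * ((a' + 3) * ((a' + 2) * (a' + 1)))
          = (2 * a' + 6) * ((2 * a' + 4) * (2 * a' + 2)) := by ring
        _ ≤ _ := by gcongr
    have h48 : 48 ≤ (a + 3) * (a + 5) := Nat.mul_le_mul (by omega : 6 ≤ a + 3) (by omega : 8 ≤ a + 5)
    refine Nat.le_of_mul_le_mul_right (c := 720) ?_ (by norm_num)
    calc 3 * (a + 1) * (a' + 3).choose 3 * 720
        = 360 * (a + 1) * ((a' + 3).choose 3 * 6) := by ring
      _ = 45 * (a + 1) * (8 * ((a' + 3) * ((a' + 2) * (a' + 1)))) := by rw [h3]; ring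
      _ ≤ ((a + 3) * (a + 5)) * (a + 1) * ((a + 6) * ((a + 4) * (a + 2))) := by
          gcongr
          omega
      _ = (a + 2 * 3).choose (2 * 3) * 720 := by
          rw [show a + 2 * 3 = a + 6 by ring, show 2 * 3 = 6 by norm_num, h6]; ring
  -- Only `6 ≤ b` is available when `b' ≤ 3`; beyond, the induction from `b' = 3` applies.
  rcases le_total b' 3 with h | h
  · calc 3 * (a + 1) * (a' + b').choose b' ≤ 3 * (a + 1) * (a' + 3).choose 3 := by
          gcongr; exact choose_add_le_choose_add h
      _ ≤ (a + 2 * 3).choose (2 * 3) := h₀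
      _ ≤ (a + b).choose b := choose_add_le_choose_add hb6
  · exact (mul_choose_le_choose_two_mul_of_le ha h h₀).trans (choose_add_le_choose_add hb)

/-- One term of Vandermonde's identity, together with `3 x ≤ C(x + 2, 2)`. -/
theorem three_mul_choose_le {a' b' x y : ℕ} (hy : 2 ≤ y) :
    3 * x * (a' + b').choose b' ≤ (a' + x + (b' + y)).choose (b' + y) := by
  have h1 : 3 * x ≤ (x + y).choose y := by
    refine le_trans ?_ (choose_add_le_choose_add hy)
    have h := Nat.add_one_mul_choose_eq (x + 1) 1
    simp only [Nat.choose_one_right] at h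
    rcases x with - | _ | x
    · simp
    · nlinarith
    · nlinarith
  calc 3 * x * (a' + b').choose b' ≤ (a' + b').choose b' * (x + y).choose y := by
        rw [mul_comm]; gcongr
    _ ≤ ∑ ij ∈ Finset.HasAntidiagonal.antidiagonal (b' + y),
          (a' + b').choose ij.1 * (x + y).choose ij.2 :=
        Finset.single_le_sum (f := fun ij : ℕ × ℕ => (a' + b').choose ij.1 * (x + y).choose ij.2)
          (fun _ _ => Nat.zero_le _)
          (Finset.HasAntidiagonal.mem_antidiagonal.mpr (rfl : (b', y).1 + _ = _))
    _ = (a' + x + (b' + y)).choose (b' + y) := by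
        rw [← Nat.add_choose_eq]; congr 1; ring

/-- The relation between counting multisets and counting words:
`(a + b) * multichoose a b = a * C(a + b, b)`. -/
theorem add_mul_multichoose (a b : ℕ) :
    (a + b) * a.multichoose b = a * (a + b).choose b := by
  rcases a with - | a
  · rcases b with - | b
    · simp
    · simp
  · rw [Nat.multichoose_eq, show a + 1 + b - 1 = a + b by omega, show a + 1 + b = a + b + 1 by ring,
      ← Nat.choose_symm_add, ← Nat.choose_symm_of_eq_add (show a + b + 1 = (a + 1) + b by ring),
      Nat.add_one_mul_choose_eq, mul_comm]

/-! ### Counting elements by order in finite abelian groups -/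

section ElementsOfGivenOrder

variable {G H : Type*} [CommGroup G] [Finite G] [CommGroup H] [Finite H]

theorem sum_numOfOrder_eq_card (G : Type*) [Group G] [Finite G] (s : Finset ℕ) :
    ∑ d ∈ s, numOfOrder G d = Nat.card {g : G // orderOf g ∈ s} := by
  classical
  have := Fintype.ofFinite G
  rw [Nat.card_eq_fintype_card, Fintype.card_subtype,
    Finset.card_eq_sum_card_fiberwise (f := orderOf) (t := s) (fun g hg => by simpa using hg)]
  refine Finset.sum_congr rfl fun d hd => ?_
  rw [numOfOrder, Nat.card_eq_fintype_card, Fintype.card_subtype]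
  congr 1
  ext g
  simp only [Finset.mem_filter, Finset.mem_univ, true_and]
  exact ⟨fun h => ⟨h ▸ hd, h⟩, fun h => h.2⟩

theorem sum_numOfOrder_le_card (G : Type*) [Group G] [Finite G] (s : Finset ℕ) :
    ∑ d ∈ s, numOfOrder G d ≤ Nat.card G := by
  rw [sum_numOfOrder_eq_card]
  exact Finite.card_subtype_le _

theorem sum_divisors_numOfOrder (G : Type*) [CommGroup G] [Finite G] {k : ℕ} (hk : k ≠ 0) :
    ∑ d ∈ k.divisors, numOfOrder G d = Nat.card (powMonoidHom k : G →* G).ker := by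
  rw [sum_numOfOrder_eq_card]
  refine Nat.card_congr (Equiv.subtypeEquivRight fun g => ?_)
  rw [MonoidHom.mem_ker, powMonoidHom_apply, ← orderOf_dvd_iff_pow_eq_one, Nat.mem_divisors]
  exact ⟨fun h => h.1, fun h => ⟨h, hk⟩⟩

theorem numOfOrder_mul_of_coprime (G : Type*) [CommGroup G] {d e : ℕ} (hd : d ≠ 0) (he : e ≠ 0)
    (h : d.Coprime e) : numOfOrder G (d * e) = numOfOrder G d * numOfOrder G e := by
  rw [numOfOrder, numOfOrder, numOfOrder, ← Nat.card_prod]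
  symm
  have hord : ∀ x y : G, orderOf x = d → orderOf y = e → orderOf (x * y) = d * e := by
    rintro x y rfl rfl
    exact (Commute.all x y).orderOf_mul_eq_mul_orderOf_of_coprime h
  refine Nat.card_eq_of_bijective
    (fun z : {g : G // orderOf g = d} × {g : G // orderOf g = e} =>
      (⟨z.1.1 * z.2.1, hord _ _ z.1.2 z.2.2⟩ : {g : G // orderOf g = d * e})) ⟨?_, ?_⟩
  · rintro ⟨⟨x, hx⟩, ⟨y, hy⟩⟩ ⟨⟨x', hx'⟩, ⟨y', hy'⟩⟩ hxy
    have hxy : x * y = x' * y' := congrArg Subtype.val hxy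
    -- The element `x / x' = y' / y` has order dividing both `d` and `e`.
    have h1 : x / x' = y' / y := div_eq_div_iff_mul_eq_mul.mpr (by rw [hxy, mul_comm])
    have h2 : (x / x') ^ d = 1 := by
      rw [div_pow, ← hx, pow_orderOf_eq_one, hx, ← hx', pow_orderOf_eq_one, div_one]
    have h3 : (x / x') ^ e = 1 := by
      rw [h1, div_pow, ← hy, pow_orderOf_eq_one, hy, ← hy', pow_orderOf_eq_one, div_one]
    have h4 : x / x' = 1 := by
      rw [← orderOf_eq_one_iff]
      exact Nat.eq_one_of_dvd_coprimes h (orderOf_dvd_of_pow_eq_one h2)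
        (orderOf_dvd_of_pow_eq_one h3)
    have h5 : y' / y = 1 := h1 ▸ h4
    rw [div_eq_one] at h4 h5
    simp [h4, h5]
  · rintro ⟨z, hz⟩
    obtain ⟨u, hu⟩ : ∃ u : ℤ × ℤ, (d : ℤ) * u.1 + e * u.2 = 1 :=
      ⟨(d.gcdA e, d.gcdB e), by rw [← Nat.gcd_eq_gcd_ab, h, Nat.cast_one]⟩
    have hx : (z ^ ((e : ℤ) * u.2)) ^ d = 1 := by
      rw [← zpow_natCast, ← zpow_mul, show (e : ℤ) * u.2 * d = ((d * e : ℕ) : ℤ) * u.2 by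
        push_cast; ring, zpow_mul, zpow_natCast, ← hz, pow_orderOf_eq_one, one_zpow]
    have hy : (z ^ ((d : ℤ) * u.1)) ^ e = 1 := by
      rw [← zpow_natCast, ← zpow_mul, show (d : ℤ) * u.1 * e = ((d * e : ℕ) : ℤ) * u.1 by
        push_cast; ring, zpow_mul, zpow_natCast, ← hz, pow_orderOf_eq_one, one_zpow]
    have hmul : z ^ ((e : ℤ) * u.2) * z ^ ((d : ℤ) * u.1) = z := by
      rw [← zpow_add, add_comm, hu, zpow_one]
    have hxd := orderOf_dvd_of_pow_eq_one hx
    have hye := orderOf_dvd_of_pow_eq_one hy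
    have hprod : orderOf (z ^ ((e : ℤ) * u.2)) * orderOf (z ^ ((d : ℤ) * u.1)) = d * e := by
      rw [← (Commute.all _ _).orderOf_mul_eq_mul_orderOf_of_coprime
        (h.of_dvd hxd hye), hmul, hz]
    have hle1 := Nat.le_of_dvd (Nat.pos_of_ne_zero hd) hxd
    have hle2 := Nat.le_of_dvd (Nat.pos_of_ne_zero he) hye
    have hx' : orderOf (z ^ ((e : ℤ) * u.2)) = d := by
      refine le_antisymm hle1 (Nat.le_of_mul_le_mul_right ?_ (Nat.pos_of_ne_zero he))
      rw [← hprod]; gcongr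
    have hy' : orderOf (z ^ ((d : ℤ) * u.1)) = e := by
      refine le_antisymm hle2 (Nat.le_of_mul_le_mul_left ?_ (Nat.pos_of_ne_zero hd))
      rw [← hprod]; gcongr
    exact ⟨(⟨_, hx'⟩, ⟨_, hy'⟩), Subtype.ext hmul⟩

theorem prime_pow_dvd_card_ker_powMonoidHom {p k : ℕ} (hp : p.Prime) (h : p ^ k ∣ Nat.card G) :
    p ^ k ∣ Nat.card (powMonoidHom (p ^ k) : G →* G).ker := by
  have := Fact.mk hp
  obtain ⟨K, hK⟩ := Sylow.exists_subgroup_card_pow_prime p h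
  rw [← hK]
  refine Subgroup.card_dvd_of_le fun g hg => ?_
  rw [MonoidHom.mem_ker, powMonoidHom_apply, ← orderOf_dvd_iff_pow_eq_one]
  exact K.orderOf_dvd_natCard hg

theorem exists_card_ker_powMonoidHom_prime_pow (G : Type*) [CommGroup G] [Finite G] {p : ℕ}
    (hp : p.Prime) (k : ℕ) : ∃ a, Nat.card (powMonoidHom (p ^ k) : G →* G).ker = p ^ a := by
  have := Fact.mk hp
  exact IsPGroup.iff_card.mp fun g => ⟨k, Subtype.ext g.2⟩

/-- Let `p ^ k` be the first power of `p` for which the numbers of elements of order `p ^ k` in `G`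
and `H` differ. The numbers of solutions of `x ^ (p ^ k) = 1` are two different powers of `p`, both
multiples of `p ^ k`; so they differ by at least `p ^ k`, and the larger one is a multiple of
`p ^ (k + 1)`. -/
theorem numOfOrder_prime_pow_gap {p k : ℕ} (hp : p.Prime) (hG : p ^ k ∣ Nat.card G)
    (hH : p ^ k ∣ Nat.card H) (heq : ∀ i < k, numOfOrder G (p ^ i) = numOfOrder H (p ^ i))
    (hlt : numOfOrder G (p ^ k) < numOfOrder H (p ^ k)) :
    numOfOrder G (p ^ k) + p ^ k ≤ numOfOrder H (p ^ k) ∧ p ^ (k + 1) ∣ Nat.card H := by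
  have hq : p ^ k ≠ 0 := pow_ne_zero _ hp.ne_zero
  have hsumG : Nat.card (powMonoidHom (p ^ k) : G →* G).ker
        = ∑ i ∈ Finset.range k, numOfOrder G (p ^ i) + numOfOrder G (p ^ k) := by
    rw [← sum_divisors_numOfOrder G hq, Nat.sum_divisors_prime_pow hp, Finset.sum_range_succ]
  have hsumH : Nat.card (powMonoidHom (p ^ k) : H →* H).ker
        = ∑ i ∈ Finset.range k, numOfOrder H (p ^ i) + numOfOrder H (p ^ k) := by
    rw [← sum_divisors_numOfOrder H hq, Nat.sum_divisors_prime_pow hp, Finset.sum_range_succ]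
  rw [← Finset.sum_congr rfl fun i hi => heq i (Finset.mem_range.mp hi)] at hsumH
  have hdG := prime_pow_dvd_card_ker_powMonoidHom hp hG
  have hdH := prime_pow_dvd_card_ker_powMonoidHom hp hH
  have hcard : Nat.card (powMonoidHom (p ^ k) : G →* G).ker
      < Nat.card (powMonoidHom (p ^ k) : H →* H).ker := by omega
  constructor
  · obtain ⟨s, hs⟩ := hdG
    obtain ⟨t, ht⟩ := hdH
    rw [hs, ht] at hcard
    have hst : s + 1 ≤ t := Nat.lt_of_mul_lt_mul_left hcard
    have := Nat.mul_le_mul_left (p ^ k) hst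
    rw [mul_add, mul_one, ← hs, ← ht] at this
    omega
  · obtain ⟨a, ha⟩ := exists_card_ker_powMonoidHom_prime_pow G hp k
    obtain ⟨b, hb⟩ := exists_card_ker_powMonoidHom_prime_pow H hp k
    rw [ha, hb, Nat.pow_lt_pow_iff_right hp.one_lt] at hcard
    rw [ha, Nat.pow_dvd_pow_iff_le_right hp.one_lt] at hdG
    exact ((pow_dvd_pow p (by omega)).trans hb.symm.dvd).trans (Subgroup.card_subgroup_dvd_card _)

/-- The elements whose order is coprime to `p` lie in a subgroup that meets the kernel of
`x ↦ x ^ (p ^ k)` trivially, and that kernel has at least `p ^ k` elements. -/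
theorem sum_numOfOrder_mul_prime_pow_le_card {p k : ℕ} (hp : p.Prime) (hG : p ^ k ∣ Nat.card G)
    {s : Finset ℕ} (hs : ∀ d ∈ s, p.Coprime d) :
    (∑ d ∈ s, numOfOrder G d) * p ^ k ≤ Nat.card G := by
  have hcop : p.Coprime (Nat.card G / p ^ (Nat.card G).factorization p) :=
    Nat.coprime_ordCompl hp Nat.card_pos.ne'
  set c := Nat.card G / p ^ (Nat.card G).factorization p with hc
  have h1 : ∑ d ∈ s, numOfOrder G d ≤ Nat.card (powMonoidHom c : G →* G).ker := by
    rw [sum_numOfOrder_eq_card]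
    refine Nat.card_le_card_of_injective
      (fun g => (⟨g.1, ?_⟩ : (powMonoidHom c : G →* G).ker)) fun x y hxy => ?_
    · rw [MonoidHom.mem_ker, powMonoidHom_apply, ← orderOf_dvd_iff_pow_eq_one]
      refine (((hs _ g.2).symm.pow_right
        ((Nat.card G).factorization p)).dvd_of_dvd_mul_left ?_)
      rw [hc, Nat.ordProj_mul_ordCompl_eq_self]
      exact orderOf_dvd_natCard g.1
    · exact Subtype.ext (congrArg (fun z => z.1) hxy)
  have h2 : p ^ k ≤ Nat.card (powMonoidHom (p ^ k) : G →* G).ker :=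
    Nat.le_of_dvd Nat.card_pos (prime_pow_dvd_card_ker_powMonoidHom hp hG)
  have h3 : Disjoint (powMonoidHom c : G →* G).ker (powMonoidHom (p ^ k) : G →* G).ker := by
    rw [Subgroup.disjoint_def]
    intro x hx hx'
    rw [MonoidHom.mem_ker, powMonoidHom_apply] at hx hx'
    rw [← orderOf_eq_one_iff]
    exact Nat.eq_one_of_dvd_coprimes (hcop.symm.pow_right k) (orderOf_dvd_of_pow_eq_one hx)
      (orderOf_dvd_of_pow_eq_one hx')
  calc _ ≤ Nat.card (powMonoidHom c : G →* G).ker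
        * Nat.card (powMonoidHom (p ^ k) : G →* G).ker := Nat.mul_le_mul h1 h2
    _ ≤ Nat.card G := by
      rw [← Nat.card_prod]
      exact Nat.card_le_card_of_injective _ (Subgroup.mul_injective_of_disjoint h3)

end ElementsOfGivenOrder

/-! ### Polynomial invariants of the regular representation -/

section RegularRepresentation

/-- The exponents of the monomials of degree `m` in variables indexed by `G`. -/
@[ext]
structure ExponentVector (G : Type*) [Fintype G] (m : ℕ) where
  /-- the exponent of each variable -/
  exponent : G → ℕ
  sum_exponent : ∑ h, exponent h = m

/-- `G` acts on exponents by left translation of the variables. -/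
instance (G : Type*) [Group G] [Fintype G] (m : ℕ) : MulAction G (ExponentVector G m) where
  smul g f := ⟨fun h => f.exponent (g⁻¹ * h),
    (Fintype.sum_equiv (Equiv.mulLeft g⁻¹) _ _ fun _ => rfl).trans f.sum_exponent⟩
  one_smul f := ExponentVector.ext (funext fun h => by
    change f.exponent (1⁻¹ * h) = f.exponent h
    rw [inv_one, one_mul])
  mul_smul g g' f := ExponentVector.ext (funext fun h => by
    change f.exponent ((g * g')⁻¹ * h) = f.exponent (g'⁻¹ * (g⁻¹ * h))
    rw [mul_inv_rev, mul_assoc])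

/-- Exponents of degree `m` amount to multisets of size `m`. -/
noncomputable def exponentVectorEquivSym (G : Type*) [Fintype G] [DecidableEq G] (m : ℕ) :
    ExponentVector G m ≃ Sym G m :=
  .trans ⟨fun f => ⟨f.1, f.2⟩, fun f => ⟨f.1, f.2⟩, fun _ => rfl, fun _ => rfl⟩
    (Sym.equivNatSumOfFintype G m).symm

instance (G : Type*) [Fintype G] (m : ℕ) : Finite (ExponentVector G m) := by
  classical exact .of_equiv _ (exponentVectorEquivSym G m).symm

theorem card_exponentVector (G : Type*) [Fintype G] (m : ℕ) :
    Nat.card (ExponentVector G m) = (Nat.card G).multichoose m := by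
  classical
  rw [← Sym.natCard_sym_eq_multichoose, Nat.card_congr (exponentVectorEquivSym G m)]

/-- The monomial with the given exponents, as a function on the group algebra of `G`; the variable
of index `h` is the `h`-th coordinate. -/
noncomputable def monomialFunction {G : Type*} [Fintype G] {m : ℕ} (f : ExponentVector G m) :
    MonoidAlgebra ℂ G → ℂ :=
  fun v => ∏ h, v.coeff h ^ f.exponent h

theorem functionAct_monomialFunction {G : Type*} [Group G] [Fintype G] {m : ℕ} (g : G)
    (f : ExponentVector G m) :
    functionAct (Representation.leftRegular ℂ G) g (monomialFunction f)
      = monomialFunction (g⁻¹ • f) := by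
  funext v
  change ∏ h, (Representation.leftRegular ℂ G g v).coeff h ^ f.exponent h
    = ∏ h, v.coeff h ^ f.exponent (g⁻¹⁻¹ * h)
  refine Fintype.prod_equiv (Equiv.mulLeft g⁻¹) _ _ fun h => ?_
  simp

/-- The evaluation of polynomials in variables indexed by `G` at the coordinates of an element of
the group algebra. -/
noncomputable def evalCoordinates (G : Type*) : MvPolynomial G ℂ →ₐ[ℂ] (MonoidAlgebra ℂ G → ℂ) :=
  MvPolynomial.aeval fun h v => v.coeff h

theorem evalCoordinates_apply {G : Type*} (p : MvPolynomial G ℂ) (v : MonoidAlgebra ℂ G) :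
    evalCoordinates G p v = MvPolynomial.eval (fun h => v.coeff h) p := by
  have : (Pi.evalAlgHom ℂ (fun _ : MonoidAlgebra ℂ G => ℂ) v).comp (evalCoordinates G)
      = MvPolynomial.aeval fun h => v.coeff h := by
    ext h
    simp [evalCoordinates]
  exact (DFunLike.congr_fun this p).trans (by rw [MvPolynomial.aeval_eq_eval])

theorem evalCoordinates_injective (G : Type*) [Finite G] :
    Function.Injective (evalCoordinates G) := by
  intro p q h
  refine MvPolynomial.funext fun x => ?_
  have := congrFun h ((MonoidAlgebra.coeffLinearEquiv ℂ).symm (Finsupp.equivFunOnFinite.symm x))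
  rw [evalCoordinates_apply, evalCoordinates_apply] at this
  simpa using this

theorem evalCoordinates_monomial {G : Type*} [Fintype G] {m : ℕ} (f : ExponentVector G m) :
    evalCoordinates G (MvPolynomial.monomial (Finsupp.equivFunOnFinite.symm f.exponent) 1)
      = monomialFunction f := by
  funext v
  rw [evalCoordinates_apply, MvPolynomial.eval_monomial, one_mul, Finsupp.prod_fintype _ _ (by simp)]
  rfl

theorem linearIndependent_monomialFunction (G : Type*) [Fintype G] (m : ℕ) :
    LinearIndependent ℂ (monomialFunction : ExponentVector G m → _) := by
  have h := ((MvPolynomial.basisMonomials G ℂ).linearIndependent.map'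
    (evalCoordinates G).toLinearMap
    (LinearMap.ker_eq_bot.mpr (evalCoordinates_injective G))).comp
    (fun f : ExponentVector G m => Finsupp.equivFunOnFinite.symm f.exponent)
    (fun f f' hf => ExponentVector.ext (Finsupp.equivFunOnFinite.symm.injective hf))
  have heq : (monomialFunction : ExponentVector G m → _) = ((evalCoordinates G).toLinearMap ∘
      MvPolynomial.basisMonomials G ℂ) ∘ fun f => Finsupp.equivFunOnFinite.symm f.exponent := by
    funext f
    simp [← evalCoordinates_monomial]
  rw [heq]
  exact h

theorem linearForms_monoidAlgebra (G : Type*) [Finite G] :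
    linearForms (MonoidAlgebra ℂ G)
      = (MvPolynomial.homogeneousSubmodule G ℂ 1).map (evalCoordinates G).toLinearMap := by
  have := Fintype.ofFinite G
  rw [MvPolynomial.homogeneousSubmodule_one_eq_span_X, Submodule.map_span, ← Set.range_comp]
  apply le_antisymm
  · rintro _ ⟨l, rfl⟩
    have hl : LinearMap.ltoFun ℂ (MonoidAlgebra ℂ G) ℂ ℂ l = ∑ h, l (MonoidAlgebra.single h 1) •
        ((evalCoordinates G).toLinearMap ∘ MvPolynomial.X) h := by
      funext v
      have hv : v = ∑ h, v.coeff h • MonoidAlgebra.single h (1 : ℂ) := by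
        ext x
        simp
      change l v = _
      conv_lhs => rw [hv]
      simp only [map_sum, map_smul, smul_eq_mul, evalCoordinates]
      simp [mul_comm]
    rw [hl]
    exact Submodule.sum_mem _ fun h _ => Submodule.smul_mem _ _ (Submodule.subset_span ⟨h, rfl⟩)
  · rw [Submodule.span_le]
    rintro _ ⟨h, rfl⟩
    refine ⟨Finsupp.lapply h ∘ₗ (MonoidAlgebra.coeffLinearEquiv ℂ).toLinearMap, ?_⟩
    funext v
    simp [evalCoordinates]

theorem polyFunctionsOfDegree_monoidAlgebra (G : Type*) [Fintype G] (m : ℕ) :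
    polyFunctionsOfDegree (MonoidAlgebra ℂ G) m
      = Submodule.span ℂ (Set.range (monomialFunction : ExponentVector G m → _)) := by
  rw [polyFunctionsOfDegree, linearForms_monoidAlgebra, ← Submodule.map_pow,
    MvPolynomial.homogeneousSubmodule_one_pow]
  apply le_antisymm
  · rw [Submodule.map_le_iff_le_comap]
    intro p hp
    rw [Submodule.mem_comap, p.as_sum, map_sum]
    refine Submodule.sum_mem _ fun e he => ?_
    have hdeg : ∑ h, e h = m := by
      have := (MvPolynomial.mem_homogeneousSubmodule m p).mp hp (MvPolynomial.mem_support_iff.mp he)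
      rw [← Finsupp.degree_eq_sum]
      exact (DFunLike.congr_fun Finsupp.degree_eq_weight_one e).trans this
    have he' : MvPolynomial.monomial e (p.coeff e)
        = p.coeff e • MvPolynomial.monomial (Finsupp.equivFunOnFinite.symm (⇑e)) 1 := by
      simp [MvPolynomial.smul_monomial]
    rw [he', map_smul]
    refine Submodule.smul_mem _ _ (Submodule.subset_span ⟨⟨⇑e, hdeg⟩, ?_⟩)
    exact (evalCoordinates_monomial ⟨⇑e, hdeg⟩).symm
  · rw [Submodule.span_le]
    rintro _ ⟨f, rfl⟩
    refine ⟨_, ?_, evalCoordinates_monomial f⟩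
    refine MvPolynomial.isHomogeneous_monomial _ ?_
    rw [Finsupp.degree_eq_sum]
    exact f.sum_exponent

theorem polyFunctionsOfDegree_le (V : Type*) [AddCommGroup V] [Module ℂ V] (m : ℕ) :
    polyFunctionsOfDegree V m ≤ Subalgebra.toSubmodule (polyFunctions V) := by
  rw [polyFunctionsOfDegree]
  induction m with
  | zero =>
    rw [pow_zero]
    exact Submodule.one_le.mpr (one_mem (polyFunctions V))
  | succ m ih =>
    rw [pow_succ]
    exact Submodule.mul_le.mpr fun a ha b hb =>
      mul_mem (S := Subalgebra ℂ (V → ℂ)) (ih ha) (Algebra.subset_adjoin hb)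

/-- A combination of monomials is invariant exactly when its coefficients are constant on the
orbits of `G` on monomials. -/
theorem finrank_invariantsOfDegree_leftRegular (G : Type*) [Group G] [Fintype G] (m : ℕ) :
    Module.finrank ℂ (invariantsOfDegree (Representation.leftRegular ℂ G) m)
      = Nat.card (Quotient (MulAction.orbitRel G (ExponentVector G m))) := by
  have := Fintype.ofFinite (ExponentVector G m)
  have := Fintype.ofFinite (Quotient (MulAction.orbitRel G (ExponentVector G m)))
  let L : (ExponentVector G m → ℂ) →ₗ[ℂ] (MonoidAlgebra ℂ G → ℂ) :=
    Fintype.linearCombination ℂ monomialFunction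
  have hL : Function.Injective L :=
    (linearIndependent_monomialFunction G m).fintypeLinearCombination_injective
  let P : (Quotient (MulAction.orbitRel G (ExponentVector G m)) → ℂ) →ₗ[ℂ]
      (ExponentVector G m → ℂ) := LinearMap.funLeft ℂ ℂ (Quotient.mk _)
  have hP : Function.Injective P :=
    LinearMap.funLeft_injective_of_surjective ℂ ℂ _ Quotient.mk_surjective
  have hact : ∀ g c, functionAct (Representation.leftRegular ℂ G) g (L c)
      = L fun f => c (g • f) := by
    intro g c
    simp only [L, Fintype.linearCombination_apply, map_sum, map_smul, functionAct_monomialFunction]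
    refine Fintype.sum_equiv (MulAction.toPerm g⁻¹) _ _ fun f => ?_
    simp
  have hrange : LinearMap.range (L ∘ₗ P)
      = invariantsOfDegree (Representation.leftRegular ℂ G) m := by
    have hLrange : LinearMap.range L = polyFunctionsOfDegree (MonoidAlgebra ℂ G) m := by
      rw [polyFunctionsOfDegree_monoidAlgebra]
      exact Fintype.range_linearCombination ℂ _
    ext F
    constructor
    · rintro ⟨c, rfl⟩
      have hmem : (L ∘ₗ P) c ∈ polyFunctionsOfDegree (MonoidAlgebra ℂ G) m := by
        rw [← hLrange]; exact ⟨P c, rfl⟩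
      refine ⟨⟨polyFunctionsOfDegree_le _ _ hmem, fun g => ?_⟩, hmem⟩
      rw [LinearMap.comp_apply, hact]
      congr 1
      funext f
      exact congrArg c (Quotient.sound ⟨g, rfl⟩)
    · rintro ⟨⟨-, hinv⟩, hF⟩
      have hF' : F ∈ LinearMap.range L := by rw [hLrange]; exact hF
      obtain ⟨c, rfl⟩ := hF'
      have hc : ∀ g f, c (g • f) = c f := fun g f =>
        congrFun (hL ((hact g c).symm.trans (hinv g))) f
      refine ⟨Quotient.lift c ?_, ?_⟩
      · rintro _ f ⟨g, rfl⟩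
        exact hc g f
      · rfl
  rw [← hrange, LinearMap.finrank_range_of_inj (f := L ∘ₗ P) (hL.comp hP),
    Module.finrank_fintype_fun_eq_card, Nat.card_eq_fintype_card]

/-- The exponents fixed by `g` are the functions on `G ⧸ ⟨g⟩`; the sum of the values of such a
function over `G` is `orderOf g` times its sum over the quotient. -/
theorem card_fixedBy_exponentVector {G : Type*} [CommGroup G] [Fintype G] (m : ℕ) (g : G) :
    Nat.card (MulAction.fixedBy (ExponentVector G m) g)
      = if orderOf g ∣ m then
          (Nat.card G / orderOf g).multichoose (m / orderOf g) else 0 := by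
  have := Fintype.ofFinite (G ⧸ Subgroup.zpowers g)
  have hpos : 0 < orderOf g := orderOf_pos g
  have hfix : ∀ f ∈ MulAction.fixedBy (ExponentVector G m) g, ∀ x y : G,
      (x : G ⧸ Subgroup.zpowers g) = y → f.exponent x = f.exponent y := by
    intro f hf x y hxy
    obtain ⟨i, hi⟩ := Subgroup.mem_zpowers_iff.mp (QuotientGroup.eq.mp hxy)
    have hmem : g ^ i ∈ MulAction.stabilizer G f :=
      Subgroup.zpow_mem _ (MulAction.mem_stabilizer_iff.mpr hf) i
    have h : (g ^ i • f).1 y = f.exponent y := by rw [MulAction.mem_stabilizer_iff.mp hmem]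
    change f.exponent ((g ^ i)⁻¹ * y) = f.exponent y at h
    rw [← h, hi, mul_inv_rev, inv_inv, mul_comm, mul_inv_cancel_left]
  have hsum : ∀ F : G ⧸ Subgroup.zpowers g → ℕ,
      ∑ x : G, F (x : G ⧸ Subgroup.zpowers g) = orderOf g * ∑ y, F y := by
    classical
    intro F
    rw [← Finset.sum_fiberwise (s := Finset.univ) (g := fun x : G => (x : G ⧸ Subgroup.zpowers g)),
      Finset.mul_sum]
    refine Finset.sum_congr rfl fun y _ => ?_
    rw [Finset.sum_congr rfl (g := fun _ => F y)
      (fun x hx => by rw [(Finset.mem_filter.mp hx).2]), Finset.sum_const, smul_eq_mul]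
    congr 1
    obtain ⟨y, rfl⟩ := QuotientGroup.mk_surjective y
    rw [← Nat.card_zpowers, ← Fintype.card_subtype, ← Nat.card_eq_fintype_card]
    refine (Nat.card_congr ((Equiv.mulLeft y).subtypeEquiv fun z => ?_)).symm
    rw [Equiv.coe_mulLeft, eq_comm, QuotientGroup.eq, inv_mul_cancel_left]
  have hcardq : Nat.card (G ⧸ Subgroup.zpowers g) = Nat.card G / orderOf g := by
    rw [Subgroup.card_eq_card_quotient_mul_card_subgroup (Subgroup.zpowers g), Nat.card_zpowers,
      Nat.mul_div_cancel _ hpos]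
  split_ifs with hd
  · rw [← hcardq, ← card_exponentVector]
    symm
    refine Nat.card_eq_of_bijective (fun F : ExponentVector (G ⧸ Subgroup.zpowers g) _ =>
      (⟨⟨fun x => F.exponent x, by rw [hsum, F.sum_exponent, Nat.mul_div_cancel' hd]⟩, ?_⟩ :
        MulAction.fixedBy (ExponentVector G m) g)) ⟨?_, ?_⟩
    · refine ExponentVector.ext (funext fun x =>
        congrArg F.exponent (?_ : ((g⁻¹ * x : G) : G ⧸ Subgroup.zpowers g) = x))
      rw [QuotientGroup.eq, mul_inv_rev, inv_inv, mul_right_comm, inv_mul_cancel, one_mul]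
      exact Subgroup.mem_zpowers g
    · intro F F' h
      refine ExponentVector.ext (funext fun y => ?_)
      obtain ⟨y, rfl⟩ := QuotientGroup.mk_surjective y
      exact congrFun (congrArg (fun f => f.1.exponent) h) y
    · rintro ⟨f, hf⟩
      have hout : ∀ x : G, f.exponent (x : G ⧸ Subgroup.zpowers g).out = f.exponent x := fun x =>
        hfix f hf _ _ (QuotientGroup.out_eq' _)
      refine ⟨⟨fun y => f.exponent y.out, ?_⟩, Subtype.ext (ExponentVector.ext (funext hout))⟩
      rw [Nat.eq_div_iff_mul_eq_left hpos.ne' hd, mul_comm, ← hsum]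
      exact f.sum_exponent.symm.trans (Finset.sum_congr rfl fun x _ => (hout x).symm)
  · rw [Nat.card_eq_zero]
    left
    refine ⟨fun ⟨f, hf⟩ => hd ⟨∑ y : G ⧸ Subgroup.zpowers g, f.exponent y.out, ?_⟩⟩
    rw [← hsum fun y => f.exponent y.out]
    exact f.sum_exponent.symm.trans
      (Finset.sum_congr rfl fun x _ => (hfix f hf _ _ (QuotientGroup.out_eq' _)).symm)

/-- Burnside's lemma for the action on monomials, written symmetrically in `|G|` and `m`. -/
theorem add_mul_finrank_invariantsOfDegree (G : Type*) [CommGroup G] [Finite G] {m : ℕ}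
    (hm : m ≠ 0) :
    (Nat.card G + m) * Module.finrank ℂ (invariantsOfDegree (Representation.leftRegular ℂ G) m)
      = ∑ d ∈ (Nat.gcd (Nat.card G) m).divisors,
          numOfOrder G d * (Nat.card G / d + m / d).choose (m / d) := by
  classical
  have := Fintype.ofFinite G
  have hn : Nat.card G ≠ 0 := Nat.card_pos.ne'
  have (g : G) := Fintype.ofFinite (MulAction.fixedBy (ExponentVector G m) g)
  have := Fintype.ofFinite (Quotient (MulAction.orbitRel G (ExponentVector G m)))
  have hburnside := MulAction.sum_card_fixedBy_eq_card_orbits_mul_card_group G (ExponentVector G m)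
  simp only [← Nat.card_eq_fintype_card, card_fixedBy_exponentVector,
    ← finrank_invariantsOfDegree_leftRegular] at hburnside
  have hterm : ∀ g : G, (Nat.card G + m) * (if orderOf g ∣ m then
      (Nat.card G / orderOf g).multichoose (m / orderOf g) else 0)
      = Nat.card G * if orderOf g ∈ (Nat.gcd (Nat.card G) m).divisors then
        (Nat.card G / orderOf g + m / orderOf g).choose (m / orderOf g) else 0 := by
    intro g
    have hdvd : orderOf g ∈ (Nat.gcd (Nat.card G) m).divisors ↔ orderOf g ∣ m := by
      rw [Nat.mem_divisors, Nat.dvd_gcd_iff]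
      exact ⟨fun h => h.1.2, fun h => ⟨⟨orderOf_dvd_natCard g, h⟩, Nat.gcd_ne_zero_right hm⟩⟩
    simp only [hdvd]
    split_ifs with h
    · obtain ⟨a, ha⟩ := orderOf_dvd_natCard g
      obtain ⟨b, hb⟩ := h
      have hpos : 0 < orderOf g := orderOf_pos g
      rw [ha, Nat.mul_div_cancel_left _ hpos]
      conv_lhs => rw [hb]
      conv_rhs => rw [hb]
      rw [Nat.mul_div_cancel_left _ hpos, ← mul_add, mul_assoc, add_mul_multichoose, mul_assoc]
    · simp
  have hsum : ∑ g : G, (if orderOf g ∈ (Nat.gcd (Nat.card G) m).divisors then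
        (Nat.card G / orderOf g + m / orderOf g).choose (m / orderOf g) else 0)
      = ∑ d ∈ (Nat.gcd (Nat.card G) m).divisors,
          numOfOrder G d * (Nat.card G / d + m / d).choose (m / d) := by
    rw [← Finset.sum_filter, ← Finset.sum_fiberwise_of_maps_to (g := orderOf)
      (t := (Nat.gcd (Nat.card G) m).divisors) (fun g hg => (Finset.mem_filter.mp hg).2)]
    refine Finset.sum_congr rfl fun d hd => ?_
    rw [Finset.sum_congr rfl (g := fun _ => (Nat.card G / d + m / d).choose (m / d))
      (fun x hx => by rw [(Finset.mem_filter.mp hx).2]), Finset.sum_const, smul_eq_mul]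
    congr 1
    rw [numOfOrder, Nat.card_eq_fintype_card (α := {g : G // orderOf g = d}),
      Fintype.card_subtype, Finset.filter_filter]
    congr 1
    ext g
    simp only [Finset.mem_filter, Finset.mem_univ, true_and]
    exact ⟨fun h => h.2, fun h => ⟨h ▸ hd, h⟩⟩
  refine Nat.eq_of_mul_eq_mul_left (Nat.pos_of_ne_zero hn) ?_
  rw [← hsum, Finset.mul_sum, ← Finset.sum_congr rfl fun g _ => hterm g, ← Finset.mul_sum,
    hburnside]
  ring

end RegularRepresentation

/-! ### The smallest order at which the two groups differ -/

section Comparison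

/-- Let `q = p ^ k` be minimal among the common orders `d` with `φ_G(d) ≠ φ_H(d)`. If `d` is a
larger common order with `φ_G(d) ≠ φ_H(d)` and `d < 2 * q`, then `d` is coprime to `p`: otherwise
both the `p`-part of `d` and its complement are less than `q`, where the counts agree. -/
theorem coprime_of_numOfOrder_ne {G H : Type*} [CommGroup G] [CommGroup H] {p k c d : ℕ}
    (hp : p.Prime) (hmin : ∀ d < p ^ k, d ∣ c → numOfOrder G d = numOfOrder H d)
    (hdc : d ∣ c) (hqd : p ^ k < d) (hdq : d < 2 * p ^ k)
    (hne : numOfOrder G d ≠ numOfOrder H d) : p.Coprime d := by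
  refine (Nat.Prime.coprime_iff_not_dvd hp).mpr fun hpd => hne ?_
  obtain ⟨i, e, hpe, rfl⟩ := Nat.exists_eq_pow_mul_and_not_dvd (n := d) (by omega) p hp.ne_one
  have he : e ≠ 0 := by
    rintro rfl
    exact hpe (dvd_zero p)
  have hi : i ≠ 0 := by
    rintro rfl
    exact hpe (by simpa using hpd)
  have hik : i < k := by
    by_contra! hik
    obtain ⟨t, ht⟩ := (pow_dvd_pow p hik).mul_right e
    rw [ht] at hqd hdq
    have h1 : 1 < t := by
      by_contra! h
      have := Nat.mul_le_mul_left (p ^ k) h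
      omega
    have := Nat.mul_le_mul_left (p ^ k) h1
    lia
  have h2 : 2 ≤ p ^ i := hp.two_le.trans (Nat.le_self_pow hi p)
  have heq : e < p ^ k := by nlinarith
  have hcop : (p ^ i).Coprime e := ((Nat.Prime.coprime_iff_not_dvd hp).mpr hpe).pow_left i
  have hpi : p ^ i ≠ 0 := pow_ne_zero _ hp.ne_zero
  rw [numOfOrder_mul_of_coprime G hpi he hcop, numOfOrder_mul_of_coprime H hpi he hcop,
    hmin _ (Nat.pow_lt_pow_right hp.one_lt hik) (dvd_of_mul_right_dvd hdc),
    hmin e heq (dvd_of_mul_left_dvd hdc)]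

/-- The smallest place where two multiplicative functions differ is a prime power. -/
theorem exists_eq_prime_pow_of_numOfOrder_ne {G H : Type*} [CommGroup G] [Finite G] [CommGroup H]
    [Finite H] {c d : ℕ} (hc : c ≠ 0) (hdc : d ∣ c)
    (hmin : ∀ d' < d, d' ∣ c → numOfOrder G d' = numOfOrder H d')
    (hne : numOfOrder G d ≠ numOfOrder H d) : ∃ p k, p.Prime ∧ k ≠ 0 ∧ d = p ^ k := by
  have hd0 : d ≠ 0 := ne_zero_of_dvd_ne_zero hc hdc
  have hd1 : d ≠ 1 := by
    rintro rfl
    simp [numOfOrder] at hne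
  have hp := Nat.minFac_prime hd1
  obtain ⟨i, e, hpe, hd⟩ := Nat.exists_eq_pow_mul_and_not_dvd hd0 d.minFac hp.ne_one
  have hi : i ≠ 0 := by
    intro hi
    rw [hi, pow_zero, one_mul] at hd
    exact hpe (hd ▸ Nat.minFac_dvd d)
  generalize d.minFac = p at hp hpe hd
  subst hd
  refine ⟨p, i, hp, hi, ?_⟩
  by_contra hne'
  have he0 : e ≠ 0 := right_ne_zero_of_mul hd0
  have he1 : e ≠ 1 := fun h => hne' (by rw [h, mul_one])
  have hpi : p ^ i ≠ 0 := pow_ne_zero _ hp.ne_zero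
  have hpi1 : 1 < p ^ i := Nat.one_lt_pow hi hp.one_lt
  have hcop : (p ^ i).Coprime e := ((Nat.Prime.coprime_iff_not_dvd hp).mpr hpe).pow_left i
  apply hne
  rw [numOfOrder_mul_of_coprime G hpi he0 hcop, numOfOrder_mul_of_coprime H hpi he0 hcop,
    hmin (p ^ i) (lt_mul_of_one_lt_right (by omega) (by omega)) (dvd_of_mul_right_dvd hdc),
    hmin e (lt_mul_of_one_lt_left (by omega) hpi1) (dvd_of_mul_left_dvd hdc)]

/-- The weight at a common divisor `d ≥ 2 * q` is smaller than the weight at `q` by a factor of at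
least `a + 1`, so that the `q * a` elements of a group of that order contribute, taken together,
less than `q` times the weight at `q`. -/
theorem mul_choose_div_le_of_two_mul_le {q a b d : ℕ} (hq : 0 < q) (hb : 0 < b)
    (hda : d ∣ q * a) (hdb : d ∣ q * b) (hqd : 2 * q ≤ d) :
    (a + 1) * (q * a / d + q * b / d).choose (q * b / d) ≤ (a + b).choose b ∧
      (3 ≤ a → 6 ≤ b →
        3 * (a + 1) * (q * a / d + q * b / d).choose (q * b / d) ≤ (a + b).choose b) := by
  obtain ⟨a', ha'⟩ := hda
  obtain ⟨b', hb'⟩ := hdb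
  have hd : 0 < d := by omega
  have h0 : 0 < b' := Nat.pos_of_mul_pos_left (hb' ▸ Nat.mul_pos hq hb)
  have h1 : 2 * a' ≤ a := by
    refine Nat.le_of_mul_le_mul_left (c := q) ?_ hq
    rw [ha', mul_left_comm, ← mul_assoc]
    exact Nat.mul_le_mul_right _ hqd
  have h2 : 2 * b' ≤ b := by
    refine Nat.le_of_mul_le_mul_left (c := q) ?_ hq
    rw [hb', mul_left_comm, ← mul_assoc]
    exact Nat.mul_le_mul_right _ hqd
  rw [ha', hb', Nat.mul_div_cancel_left _ hd, Nat.mul_div_cancel_left _ hd]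
  exact ⟨add_one_mul_choose_le h1 h2 h0, three_mul_add_one_mul_choose_le h1 h2⟩

/-- For a common divisor `d` coprime to `q` with `q < d < 2 * q`, the weight is smaller than the
weight at `q` by a factor of at least `3 * a / (2 * q)`. The divisibility by `p` ensures that `b`
is at least `2 * d`. -/
theorem mul_choose_div_le_of_coprime {p q a b d : ℕ} (hp : p.Prime) (hq : 2 ≤ q) (ha : 0 < a)
    (hb : 0 < b) (hpb : p ∣ b) (hpd : p.Coprime d) (hcop : q.Coprime d) (hda : d ∣ q * a)
    (hdb : d ∣ q * b) (hqd : q < d) (hdq : d < 2 * q) :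
    3 ≤ a ∧ 6 ≤ b ∧
      3 * a * (q * a / d + q * b / d).choose (q * b / d) ≤ 2 * q * (a + b).choose b := by
  obtain ⟨t, rfl⟩ : d ∣ a := hcop.symm.dvd_of_dvd_mul_left hda
  obtain ⟨u, rfl⟩ : d ∣ b := hcop.symm.dvd_of_dvd_mul_left hdb
  have hd : 0 < d := by omega
  have ht : 1 ≤ t := Nat.pos_of_mul_pos_left ha
  have hu : 2 ≤ u := hp.two_le.trans
    (Nat.le_of_dvd (Nat.pos_of_mul_pos_left hb) (hpd.dvd_of_dvd_mul_left hpb))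
  obtain ⟨r, rfl, hr⟩ : ∃ r, d = q + r ∧ 1 ≤ r := ⟨d - q, by omega, by omega⟩
  rw [mul_left_comm q _ t, mul_left_comm q _ u, Nat.mul_div_cancel_left _ hd,
    Nat.mul_div_cancel_left _ hd]
  have hmain : 3 * (r * t) * (q * t + q * u).choose (q * u)
      ≤ ((q + r) * t + (q + r) * u).choose ((q + r) * u) := by
    rw [add_mul, add_mul]
    exact three_mul_choose_le (hu.trans (Nat.le_mul_of_pos_left u hr))
  refine ⟨Nat.mul_le_mul (Nat.add_le_add hq hr) ht, Nat.mul_le_mul (Nat.add_le_add hq hr) hu, ?_⟩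
  calc 3 * ((q + r) * t) * (q * t + q * u).choose (q * u)
      = (q + r) * (3 * t * (q * t + q * u).choose (q * u)) := by ring
    _ ≤ 2 * q * (3 * (r * t) * (q * t + q * u).choose (q * u)) := by
        gcongr
        exact Nat.le_mul_of_pos_left t hr
    _ ≤ _ := by gcongr

/-- The first difference dominates: if `p ^ k` is the smallest common order at which the counts
differ and `φ_G(p ^ k) < φ_H(p ^ k)`, then the weighted sum for `G` is smaller than that for `H`. -/
theorem sum_numOfOrder_mul_choose_lt {G H : Type*} [CommGroup G] [Finite G] [CommGroup H]
    [Finite H] {n m p k : ℕ} (hn : Nat.card G = n) (hm : Nat.card H = m) (hp : p.Prime)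
    (hk : k ≠ 0) (hqc : p ^ k ∣ Nat.gcd n m)
    (hmin : ∀ d < p ^ k, d ∣ Nat.gcd n m → numOfOrder G d = numOfOrder H d)
    (hlt : numOfOrder G (p ^ k) < numOfOrder H (p ^ k)) :
    ∑ d ∈ (Nat.gcd n m).divisors, numOfOrder G d * (n / d + m / d).choose (m / d)
      < ∑ d ∈ (Nat.gcd n m).divisors, numOfOrder H d * (n / d + m / d).choose (m / d) := by
  classical
  have hn0 : 0 < n := hn ▸ Nat.card_pos
  have hm0 : 0 < m := hm ▸ Nat.card_pos
  have hc0 : Nat.gcd n m ≠ 0 := Nat.gcd_ne_zero_left hn0.ne'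
  have hqn := hqc.trans (Nat.gcd_dvd_left n m)
  have hqm := hqc.trans (Nat.gcd_dvd_right n m)
  obtain ⟨hgap, hpm⟩ := numOfOrder_prime_pow_gap hp (hn.symm ▸ hqn) (hm.symm ▸ hqm)
    (fun i hi => hmin _ (Nat.pow_lt_pow_right hp.one_lt hi)
      ((pow_dvd_pow p hi.le).trans hqc)) hlt
  have hq2 : 2 ≤ p ^ k := hp.two_le.trans (Nat.le_self_pow hk p)
  have hcount (s : Finset ℕ) (hs : ∀ d ∈ s, p.Coprime d) :=
    sum_numOfOrder_mul_prime_pow_le_card hp (hn.symm ▸ hqn) hs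
  have hcop := fun d => coprime_of_numOfOrder_ne (d := d) hp hmin
  have hqp : ∀ d, p.Coprime d → (p ^ k).Coprime d := fun d h => h.pow_left k
  rw [pow_succ, hm] at hpm
  generalize p ^ k = q at *
  obtain ⟨a, ha⟩ := hqn
  obtain ⟨b, hb⟩ := hqm
  have hpb : p ∣ b := by
    rw [hb] at hpm
    exact Nat.dvd_of_mul_dvd_mul_left (by omega) hpm
  have ha0 : 0 < a := Nat.pos_of_ne_zero fun h => by simp [h] at ha; omega
  have hb0 : 0 < b := Nat.pos_of_ne_zero fun h => by simp [h] at hb; omega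
  have hdiva : n / q = a := by rw [ha, Nat.mul_div_cancel_left _ (by omega)]
  have hdivb : m / q = b := by rw [hb, Nat.mul_div_cancel_left _ (by omega)]
  set w : ℕ → ℕ := fun d => (n / d + m / d).choose (m / d) with hw
  have hwq : w q = (a + b).choose b := by simp only [hw, hdiva, hdivb]
  have hwq0 : 0 < w q := by rw [hwq]; exact Nat.choose_pos (by omega)
  -- The common orders above `q` at which the counts differ, split at `2 * q`.
  set D := {d ∈ (Nat.gcd n m).divisors | q < d ∧ numOfOrder G d ≠ numOfOrder H d} with hD
  have hDdvd : ∀ d ∈ D, d ∣ n ∧ d ∣ m ∧ q < d := fun d hd => by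
    rw [hD, Finset.mem_filter, Nat.mem_divisors, Nat.dvd_gcd_iff] at hd
    exact ⟨hd.1.1.1, hd.1.1.2, hd.2.1⟩
  have hlarge : ∀ d ∈ D, 2 * q ≤ d → (a + 1) * w d ≤ w q ∧
      (3 ≤ a → 6 ≤ b → 3 * (a + 1) * w d ≤ w q) := by
    intro d hd hqd
    obtain ⟨h1, h2, -⟩ := hDdvd d hd
    rw [hwq]
    simp only [hw]
    rw [ha] at h1 ⊢
    rw [hb] at h2 ⊢
    exact mul_choose_div_le_of_two_mul_le (by omega) hb0 h1 h2 hqd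
  have hsmall : ∀ d ∈ D, d < 2 * q → p.Coprime d ∧ 3 ≤ a ∧ 6 ≤ b ∧ 3 * a * w d ≤ 2 * q * w q := by
    intro d hd hdq
    obtain ⟨h1, h2, h3⟩ := hDdvd d hd
    have hpd : p.Coprime d := by
      rw [hD, Finset.mem_filter] at hd
      exact hcop d (Nat.dvd_of_mem_divisors hd.1) hd.2.1 hdq hd.2.2
    rw [hwq]
    simp only [hw]
    rw [ha] at h1 ⊢
    rw [hb] at h2 ⊢
    exact ⟨hpd, mul_choose_div_le_of_coprime hp hq2 ha0 hb0 hpb hpd (hqp d hpd) h1 h2 h3 hdq⟩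
  have hsumlarge : ∀ c, (∀ d ∈ D, 2 * q ≤ d → c * w d ≤ w q) →
      c * ∑ d ∈ D with 2 * q ≤ d, numOfOrder G d * w d ≤ q * a * w q := by
    intro c hc
    calc c * ∑ d ∈ D with 2 * q ≤ d, numOfOrder G d * w d
        ≤ ∑ d ∈ D with 2 * q ≤ d, numOfOrder G d * w q := by
          rw [Finset.mul_sum]
          refine Finset.sum_le_sum fun d hd => ?_
          rw [Finset.mem_filter] at hd
          rw [mul_left_comm]
          exact Nat.mul_le_mul_left _ (hc d hd.1 hd.2)
      _ ≤ q * a * w q := by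
          rw [← Finset.sum_mul, ← ha, ← hn]
          exact Nat.mul_le_mul_right _ (sum_numOfOrder_le_card G _)
  -- If no order of `D` is below `2 * q`, the factor `a + 1` suffices. Otherwise the orders above
  -- and below `2 * q` contribute less than one third and at most two thirds of `q * w q`.
  have hrest : ∑ d ∈ D, numOfOrder G d * w d < q * w q := by
    rw [← Finset.sum_filter_add_sum_filter_not D (fun d => 2 * q ≤ d)]
    rcases Finset.eq_empty_or_nonempty {d ∈ D | ¬ 2 * q ≤ d} with hempty | ⟨d₀, hd₀⟩
    · rw [hempty, Finset.sum_empty, add_zero]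
      have h := hsumlarge (a + 1) fun d hd hqd => (hlarge d hd hqd).1
      refine Nat.lt_of_mul_lt_mul_left (a := a + 1) (h.trans_lt ?_)
      nlinarith [Nat.mul_pos (show 0 < q by omega) hwq0]
    · rw [Finset.mem_filter, not_le] at hd₀
      obtain ⟨-, ha3, hb6, -⟩ := hsmall d₀ hd₀.1 hd₀.2
      have h1 := hsumlarge (3 * (a + 1)) fun d hd hqd => (hlarge d hd hqd).2 ha3 hb6
      have hnum : ∑ d ∈ D with ¬ 2 * q ≤ d, numOfOrder G d ≤ a := by
        refine Nat.le_of_mul_le_mul_right (c := q) ?_ (by omega)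
        rw [mul_comm a q, ← ha, ← hn]
        refine hcount _ fun d hd => ?_
        rw [Finset.mem_filter, not_le] at hd
        exact (hsmall d hd.1 hd.2).1
      have h2 : a * (3 * ∑ d ∈ D with ¬ 2 * q ≤ d, numOfOrder G d * w d) ≤ a * (2 * q * w q) :=
        calc a * (3 * ∑ d ∈ D with ¬ 2 * q ≤ d, numOfOrder G d * w d)
            ≤ ∑ d ∈ D with ¬ 2 * q ≤ d, numOfOrder G d * (2 * q * w q) := by
              rw [← mul_assoc, mul_comm a 3, Finset.mul_sum]
              refine Finset.sum_le_sum fun d hd => ?_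
              rw [Finset.mem_filter, not_le] at hd
              rw [mul_left_comm]
              exact Nat.mul_le_mul_left _ (hsmall d hd.1 hd.2).2.2.2
          _ ≤ a * (2 * q * w q) := by
              rw [← Finset.sum_mul]
              exact Nat.mul_le_mul_right _ hnum
      have h3 := Nat.le_of_mul_le_mul_left h2 ha0
      have h4 : 3 * ∑ d ∈ D with 2 * q ≤ d, numOfOrder G d * w d < q * w q := by
        refine Nat.lt_of_mul_lt_mul_left (a := a + 1) (lt_of_le_of_lt (b := q * a * w q) ?_ ?_)
        · rw [← mul_assoc, mul_comm (a + 1) 3]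
          exact h1
        · nlinarith [Nat.mul_pos (show 0 < q by omega) hwq0]
      rw [mul_assoc] at h3
      omega
  have hqmem : q ∈ (Nat.gcd n m).divisors := Nat.mem_divisors.mpr ⟨hqc, hc0⟩
  have hpointwise : ∀ d ∈ (Nat.gcd n m).divisors.erase q, numOfOrder G d * w d
      ≤ numOfOrder H d * w d + if q < d ∧ numOfOrder G d ≠ numOfOrder H d then
        numOfOrder G d * w d else 0 := by
    intro d hd
    rw [Finset.mem_erase] at hd
    split_ifs with h
    · exact Nat.le_add_left _ _
    · have heq : numOfOrder G d = numOfOrder H d := by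
        rcases lt_or_gt_of_ne hd.1 with hlt' | hgt
        · exact hmin d hlt' (Nat.dvd_of_mem_divisors hd.2)
        · by_contra hne
          exact h ⟨hgt, hne⟩
      rw [heq, add_zero]
  have herase : ∑ d ∈ (Nat.gcd n m).divisors.erase q,
      (if q < d ∧ numOfOrder G d ≠ numOfOrder H d then numOfOrder G d * w d else 0)
      ≤ ∑ d ∈ D, numOfOrder G d * w d := by
    rw [hD, Finset.sum_filter]
    exact Finset.sum_le_sum_of_subset (Finset.erase_subset _ _)
  have hsumle := Finset.sum_le_sum hpointwise
  rw [Finset.sum_add_distrib] at hsumle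
  have hgapw := Nat.mul_le_mul_right (w q) hgap
  rw [add_mul] at hgapw
  change ∑ d ∈ _, numOfOrder G d * w d < ∑ d ∈ _, numOfOrder H d * w d
  rw [← Finset.add_sum_erase _ _ hqmem, ← Finset.add_sum_erase _ _ hqmem]
  omega

end Comparison

theorem theorem1p2 (G H : Type*) [CommGroup G] [Finite G] [CommGroup H] [Finite H] :
    Module.finrank ℂ (invariantsOfDegree (Representation.leftRegular ℂ G) (Nat.card H)) =
        Module.finrank ℂ (invariantsOfDegree (Representation.leftRegular ℂ H) (Nat.card G)) ↔
      ∀ d : ℕ, d ∣ Nat.gcd (Nat.card G) (Nat.card H) → numOfOrder G d = numOfOrder H d := by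
  have hn0 : Nat.card G ≠ 0 := Nat.card_pos.ne'
  have hm0 : Nat.card H ≠ 0 := Nat.card_pos.ne'
  have hG := add_mul_finrank_invariantsOfDegree G hm0
  have hH := add_mul_finrank_invariantsOfDegree H hn0
  have hc : Nat.gcd (Nat.card G) (Nat.card H) ≠ 0 := Nat.gcd_ne_zero_left hn0
  -- The weights `C(|G| / d + |H| / d, |H| / d)` are symmetric in `G` and `H`.
  have hsymm : ∀ (φ : ℕ → ℕ),
      ∑ d ∈ (Nat.gcd (Nat.card H) (Nat.card G)).divisors,
        φ d * (Nat.card H / d + Nat.card G / d).choose (Nat.card G / d)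
      = ∑ d ∈ (Nat.gcd (Nat.card G) (Nat.card H)).divisors,
        φ d * (Nat.card G / d + Nat.card H / d).choose (Nat.card H / d) := by
    intro φ
    rw [Nat.gcd_comm]
    refine Finset.sum_congr rfl fun d _ => ?_
    rw [add_comm, Nat.choose_symm_add]
  rw [hsymm, add_comm (Nat.card H)] at hH
  have hiff : Module.finrank ℂ (invariantsOfDegree (Representation.leftRegular ℂ G) (Nat.card H))
      = Module.finrank ℂ (invariantsOfDegree (Representation.leftRegular ℂ H) (Nat.card G)) ↔
      ∑ d ∈ (Nat.gcd (Nat.card G) (Nat.card H)).divisors,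
        numOfOrder G d * (Nat.card G / d + Nat.card H / d).choose (Nat.card H / d)
      = ∑ d ∈ (Nat.gcd (Nat.card G) (Nat.card H)).divisors,
        numOfOrder H d * (Nat.card G / d + Nat.card H / d).choose (Nat.card H / d) := by
    rw [← hG, ← hH]
    exact (Nat.mul_right_inj (by omega)).symm
  rw [hiff]
  constructor
  · intro hsum
    by_contra hne
    push Not at hne
    classical
    obtain ⟨hdc, hd⟩ := Nat.find_spec hne
    have hmin : ∀ d' < Nat.find hne, d' ∣ Nat.gcd (Nat.card G) (Nat.card H) →
        numOfOrder G d' = numOfOrder H d' := fun d' hd' hdc' => by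
      by_contra h
      exact Nat.find_min hne hd' ⟨hdc', h⟩
    generalize Nat.find hne = d at *
    obtain ⟨p, k, hp, hk, rfl⟩ := exists_eq_prime_pow_of_numOfOrder_ne hc hdc hmin hd
    rcases lt_or_gt_of_ne hd with hlt | hlt
    · exact (sum_numOfOrder_mul_choose_lt rfl rfl hp hk hdc hmin hlt).ne hsum
    · have h := sum_numOfOrder_mul_choose_lt (G := H) (H := G) rfl rfl hp hk
        (Nat.gcd_comm _ _ ▸ hdc) (fun d' hd' hdc' => (hmin d' hd' (Nat.gcd_comm _ _ ▸ hdc')).symm)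
        hlt
      rw [hsymm, hsymm] at h
      exact h.ne' hsum
  · intro h
    exact Finset.sum_congr rfl fun d hd => by rw [h d (Nat.dvd_of_mem_divisors hd)]
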